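/- Let $n\ge 1$ be an integer and equip $\mathbb{R}^n$ with the norm $\|x\|=\max_{1\le i\le n}|x_i|$. For a function $f\colon\{1,2,3,\dots\}\to\mathbb{R}$, let $W(f)$ be the set of $x\in\mathbb{R}^n$ for which there are infinitely many rational points $\frac pq\in\mathbb{Q}^n$ (with $p\in\mathbb{Z}^n$ and $q\ge 1$ an integer) such that $\left\|x-\frac pq\right\|<f(q)$. For $\psi\colon\{1,2,3,\dots\}\to(0,\infty)$ define the set of exactly $\psi$-approximable points of $\mathbb{R}^n$ by $$E(\psi)=W(\psi)\setminus\bigcup_{c<1}W(c\psi).$$ **Theorem.** If $\psi\colon\{1,2,3,\dots\}\to(0,\infty)$ is non-increasing and $\lim_{s\to\infty}s^{\frac{n+1}{n}}\psi(s)=0$, then $E(\psi)$ is non-empty, and in fact uncountable. -/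

import Mathlib

/-- `W(f)`: the `f`-approximable points of `ℝⁿ`, i.e. the points `x` for which there are infinitely
many rational points `v = p/q ∈ ℚⁿ` (with `p ∈ ℤⁿ` and `q ≥ 1` an integer) such that
`‖x - p/q‖ < f(q)`. The norm on `Fin n → ℝ` is the maximum norm. -/
def psiApprox (n : ℕ) (f : ℕ → ℝ) : Set (Fin n → ℝ) :=
  {x | {v : Fin n → ℚ | ∃ (p : Fin n → ℤ) (q : ℕ), 1 ≤ q ∧ (∀ i, v i = (p i : ℚ) / (q : ℚ)) ∧
    ‖x - fun i => (v i : ℝ)‖ < f q}.Infinite}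

/-- `E(ψ) = W(ψ) \ ⋃_{c < 1} W(cψ)`: the exactly `ψ`-approximable points of `ℝⁿ`. -/
def exactPsiApprox (n : ℕ) (ψ : ℕ → ℝ) : Set (Fin n → ℝ) :=
  psiApprox n ψ \ ⋃ c ∈ Set.Iio (1 : ℝ), psiApprox n (fun q => c * ψ q)

/-! A point of `E(ψ)` is obtained as the limit of nested balls, each placed slightly closer than `ψ
q` to a rational `w = p/q`, so that `w` approximates well enough, but barely. The difficulty is to
keep every other rational away. To this end `w` is a best approximation of a badly approximable
point `y` (`exists_isolated_approx`): `y` controls denominators well below `q`, and for the others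
every nonzero `q' w - p'` is at least a constant times `q ^ (-1/n)`. Multiples of `(q, p)` are
harmless because `ψ` is non-increasing. Since `ψ q = o(q ^ (-(n+1)/n))`, this control lasts until
denominators so large that the new ball, of radius about `δ ψ q`, can start the next step
(`exists_next_ball`).

The constant `κ` of bad approximability depends only on `n`, so one threshold on `ψ` serves all
steps. It comes from the simplex lemma: rationals of bounded denominator in a small ball lie on one
affine hyperplane (`span_lt_top_of_small`), which a ball of a quarter of the radius can avoid
(`exists_ball_avoiding`).

Each step can also dodge a prescribed point, so no sequence exhausts `E(ψ)`. -/

/-! ### Approximation errors and the Dirichlet rate. -/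

/-- The approximation error `‖q x - p‖` of the rational point `p / q` at `x`. -/
def linErr {n : ℕ} (x : Fin n → ℝ) (q : ℕ) (p : Fin n → ℤ) : ℝ :=
  ‖(q : ℝ) • x - fun i => (p i : ℝ)‖

/-- The Dirichlet rate `q ^ (-1 / n)`. -/
noncomputable def dirichletRate (n q : ℕ) : ℝ := (q : ℝ) ^ (-(1 / (n : ℝ)))

lemma dirichletRate_pos (n : ℕ) {q : ℕ} (hq : 1 ≤ q) : 0 < dirichletRate n q :=
  Real.rpow_pos_of_pos (by exact_mod_cast hq) _

/-- Comparisons with the rate are made by taking `n`-th powers, multiplying by the denominator and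
using this identity. -/
lemma dirichletRate_pow_mul {n q : ℕ} (hn : 1 ≤ n) (hq : 1 ≤ q) :
    dirichletRate n q ^ n * q = 1 := by
  have hq' : (0 : ℝ) < q := by exact_mod_cast hq
  have hn' : (n : ℝ) ≠ 0 := by positivity
  rw [dirichletRate, ← Real.rpow_natCast, ← Real.rpow_mul hq'.le]
  rw [show -(1 / (n : ℝ)) * n = -1 by field_simp, Real.rpow_neg_one]
  field_simp

lemma le_of_pow_mul_le {n : ℕ} (hn : 1 ≤ n) {a b c : ℝ} (hb : 0 ≤ b) (hc : 0 < c)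
    (h : a ^ n * c ≤ b ^ n * c) : a ≤ b :=
  le_of_pow_le_pow_left₀ (by omega) hb (le_of_mul_le_mul_right h hc)

lemma dirichletRate_le_mul {n q q' : ℕ} (hn : 1 ≤ n) (hq : 1 ≤ q) (hq' : 1 ≤ q') {a : ℝ}
    (ha : 1 ≤ a) (h : (q : ℝ) ≤ a * q') : dirichletRate n q' ≤ a * dirichletRate n q := by
  have h1 := dirichletRate_pow_mul hn hq
  have h2 := dirichletRate_pow_mul hn hq'
  have hp := dirichletRate_pos n hq
  have hq0 : (0 : ℝ) < q := by exact_mod_cast hq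
  have hq0' : (0 : ℝ) < q' := by exact_mod_cast hq'
  refine le_of_pow_mul_le hn (by positivity) hq0' ?_
  rw [h2, mul_pow]
  have h3 : a ≤ a ^ n := le_self_pow₀ ha (by omega)
  calc (1 : ℝ) = dirichletRate n q ^ n * q := h1.symm
    _ ≤ dirichletRate n q ^ n * (a * q') := by gcongr
    _ = a * dirichletRate n q ^ n * q' := by ring
    _ ≤ _ := by gcongr

lemma dirichletRate_anti {n q q' : ℕ} (hn : 1 ≤ n) (hq : 1 ≤ q) (h : q ≤ q') :
    dirichletRate n q' ≤ dirichletRate n q := by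
  have := dirichletRate_le_mul (a := 1) hn hq (hq.trans h) le_rfl (by simpa using h)
  simpa using this

lemma dirichletRate_le_one (n : ℕ) {q : ℕ} (hq : 1 ≤ q) : dirichletRate n q ≤ 1 :=
  Real.rpow_le_one_of_one_le_of_nonpos (by exact_mod_cast hq)
    (neg_nonpos.2 (by positivity))

/-! ### The simplex lemma and hyperplane avoidance. -/

/-- A lower bound for the size of nonzero integer determinants: the vectors `(q, p)` with
`p / q` in a small ball and `q` bounded do not span the whole space. -/
lemma span_lt_top_of_small {n : ℕ} (z : Fin n → ℝ) {r Q : ℝ} (hr : 0 < r)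
    (hQ : ((n + 1).factorial : ℝ) * (Q ^ (n + 1) * r ^ n) < 1) :
    Submodule.span ℝ {v : Fin (n + 1) → ℝ | ∃ (q : ℕ) (p : Fin n → ℤ), 1 ≤ q ∧ (q : ℝ) ≤ Q ∧
      linErr z q p ≤ q * r ∧ v = Fin.cons (q : ℝ) fun i => (p i : ℝ)} < ⊤ := by
  rw [lt_top_iff_ne_top]
  intro htop
  set s := {v : Fin (n + 1) → ℝ | ∃ (q : ℕ) (p : Fin n → ℤ), 1 ≤ q ∧ (q : ℝ) ≤ Q ∧
      linErr z q p ≤ q * r ∧ v = Fin.cons (q : ℝ) fun i => (p i : ℝ)} with hs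
  obtain ⟨f, hfs, -, hfi⟩ := Submodule.exists_fun_fin_finrank_span_eq ℝ s
  have hfr : Module.finrank ℝ (Submodule.span ℝ s) = n + 1 := by
    rw [htop, finrank_top, Module.finrank_fin_fun]
  obtain ⟨g, hgs, hgi⟩ : ∃ g : Fin (n + 1) → Fin (n + 1) → ℝ,
      (∀ i, g i ∈ s) ∧ LinearIndependent ℝ g :=
    ⟨fun i => f (finCongr hfr.symm i), fun i => hfs _,
      hfi.comp _ (finCongr hfr.symm).injective⟩
  choose q p hq hqQ hqp hg using hgs
  have hdet : (Matrix.of g).det ≠ 0 := by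
    have h1 : IsUnit (Matrix.of g) := Matrix.linearIndependent_rows_iff_isUnit.1 hgi
    exact ((Matrix.isUnit_iff_isUnit_det _).1 h1).ne_zero
  have hint : (1 : ℝ) ≤ |(Matrix.of g).det| := by
    let G : Matrix (Fin (n + 1)) (Fin (n + 1)) ℤ := Matrix.of fun i => Fin.cons (q i : ℤ) (p i)
    have hG : (Matrix.of g) = G.map (Int.castRingHom ℝ) := by
      ext i j
      simp only [Matrix.of_apply, Matrix.map_apply, G, hg]
      refine Fin.cases ?_ (fun j => ?_) j <;> simp
    rw [hG, ← RingHom.mapMatrix_apply, ← RingHom.map_det] at hdet ⊢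
    have h0 : G.det ≠ 0 := fun h => hdet (by rw [h]; simp)
    have := Int.one_le_abs h0
    simpa using (by exact_mod_cast this : (1 : ℝ) ≤ |(G.det : ℝ)|)
  let B : Matrix (Fin (n + 1)) (Fin (n + 1)) ℝ :=
    Matrix.of fun i => Fin.cons (q i : ℝ) fun j => (p i j : ℝ) - q i * z j
  have hB : (Matrix.of g).det = B.det := by
    rw [← Matrix.det_transpose, ← Matrix.det_transpose B]
    -- Subtracting `z j` times the column of denominators preserves the determinant and makes the
    -- other `n` columns at most `Q * r`.
    refine Matrix.det_eq_of_forall_row_eq_smul_add_const (Fin.cons 0 z) 0 (by simp) ?_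
    intro j i
    simp only [Matrix.transpose_apply]
    simp only [Matrix.of_apply, B, hg]
    refine Fin.cases ?_ (fun j => ?_) j
    · simp
    · simp; ring
  have hQ0 : 0 ≤ Q := le_trans (by positivity) (hqQ 0)
  have hbound : |B.det| ≤ ((n + 1).factorial : ℝ) * (Q ^ (n + 1) * r ^ n) := by
    rw [Matrix.det_apply]
    refine (Finset.abs_sum_le_sum_abs _ _).trans ?_
    have : ∀ σ ∈ (Finset.univ : Finset (Equiv.Perm (Fin (n + 1)))),
        |Equiv.Perm.sign σ • ∏ i, B (σ i) i| ≤ Q ^ (n + 1) * r ^ n := by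
      intro σ _
      have h1 : |Equiv.Perm.sign σ • ∏ i, B (σ i) i| = ∏ i, |B (σ i) i| := by
        rw [← Finset.abs_prod]
        rcases Int.units_eq_one_or (Equiv.Perm.sign σ) with h | h <;> simp [h]
      rw [h1, Fin.prod_univ_succ, pow_succ' Q n, mul_assoc, ← mul_pow]
      have h2 : ∏ i : Fin n, |B (σ i.succ) i.succ| ≤ (Q * r) ^ n := by
        refine (Finset.prod_le_prod (fun _ _ => abs_nonneg _) (g := fun _ => Q * r) ?_).trans ?_
        · intro i _
          have h3 := hqp (σ i.succ)
          have h4 := norm_le_pi_norm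
            ((q (σ i.succ) : ℝ) • z - fun j => (p (σ i.succ) j : ℝ)) i
          simp only [B, Matrix.of_apply, Fin.cons_succ]
          rw [abs_sub_comm]
          simp only [Pi.sub_apply, Pi.smul_apply, smul_eq_mul, Real.norm_eq_abs] at h4
          refine h4.trans (h3.trans ?_)
          gcongr
          exact hqQ _
        · simp
      refine mul_le_mul ?_ h2 (Finset.prod_nonneg fun _ _ => abs_nonneg _) hQ0
      simp only [B, Matrix.of_apply, Fin.cons_zero, Nat.abs_cast]
      exact hqQ _
    refine (Finset.sum_le_sum this).trans ?_
    simp [Fintype.card_perm]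
  rw [hB] at hint
  linarith

lemma norm_sub_div_mul {n : ℕ} (x : Fin n → ℝ) {q : ℕ} (hq : 1 ≤ q) (p : Fin n → ℤ) :
    linErr x q p = q * ‖x - fun i => (p i : ℝ) / q‖ := by
  have hq' : (0 : ℝ) < q := by exact_mod_cast hq
  have h : ((q : ℝ) • x - fun i => (p i : ℝ)) = (q : ℝ) • (x - fun i => (p i : ℝ) / q) := by
    ext i
    simp only [Pi.sub_apply, Pi.smul_apply, smul_eq_mul]
    field_simp
  rw [linErr, h, norm_smul, Real.norm_of_nonneg hq'.le]

/-- Inside a ball of radius `r` there is a ball of radius `r / 4` that stays at distance `r / 4`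
from all rational points of small denominator. -/
lemma exists_ball_avoiding {n : ℕ} (z : Fin n → ℝ) {r : ℝ} (hr : 0 < r) :
    ∃ z' : Fin n → ℝ, ‖z' - z‖ ≤ r / 2 ∧
      ∀ x, ‖x - z'‖ ≤ r / 4 → ∀ q : ℕ, 1 ≤ q →
        ((n + 1).factorial : ℝ) * ((q : ℝ) ^ (n + 1) * r ^ n) < 1 → ∀ p : Fin n → ℤ,
          q * (r / 4) ≤ linErr x q p := by
  by_cases hex : ∃ q : ℕ, 1 ≤ q ∧ ((n + 1).factorial : ℝ) * ((q : ℝ) ^ (n + 1) * r ^ n) < 1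
  swap
  · push Not at hex
    exact ⟨z, by simpa using by positivity, fun x _ q hq h => absurd h (not_lt.2 (hex q hq))⟩
  -- Taking the largest admissible denominator gives a single hyperplane for all admissible `q`.
  have hbdd : ∃ Q : ℕ, ((n + 1).factorial : ℝ) * ((Q : ℝ) ^ (n + 1) * r ^ n) < 1 ∧
      ∀ q : ℕ, ((n + 1).factorial : ℝ) * ((q : ℝ) ^ (n + 1) * r ^ n) < 1 → q ≤ Q := by
    obtain ⟨q₀, -, hq₀⟩ := hex
    obtain ⟨M, hM⟩ := exists_nat_gt (1 / (((n + 1).factorial : ℝ) * r ^ n))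
    have hpos : 0 < ((n + 1).factorial : ℝ) * r ^ n := by positivity
    have hle : ∀ q : ℕ, ((n + 1).factorial : ℝ) * ((q : ℝ) ^ (n + 1) * r ^ n) < 1 → q ≤ M := by
      intro q hq
      by_contra hlt
      push Not at hlt
      have h1 : (M : ℝ) < q := by exact_mod_cast hlt
      have h2 : (1 : ℝ) ≤ q := by exact_mod_cast (by omega : 1 ≤ q)
      have h3 : (q : ℝ) ≤ (q : ℝ) ^ (n + 1) := le_self_pow₀ h2 (by omega)
      rw [div_lt_iff₀ hpos] at hM
      nlinarith
    classical
    refine ⟨Nat.findGreatest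
      (fun q : ℕ => ((n + 1).factorial : ℝ) * ((q : ℝ) ^ (n + 1) * r ^ n) < 1) M, ?_, ?_⟩
    · exact Nat.findGreatest_spec
        (P := fun q : ℕ => ((n + 1).factorial : ℝ) * ((q : ℝ) ^ (n + 1) * r ^ n) < 1)
        (hle q₀ hq₀) hq₀
    · exact fun q hq => Nat.le_findGreatest (hle q hq) hq
  obtain ⟨Q, hQ, hQmax⟩ := hbdd
  obtain ⟨f, hf0, hfker⟩ :=
    Submodule.exists_le_ker_of_lt_top _ (span_lt_top_of_small z hr hQ)
  set b := f (Fin.cons 1 0) with hb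
  set a : Fin n → ℝ := fun i => f (Pi.single i.succ 1) with ha
  have hfexp : ∀ (t : ℝ) (v : Fin n → ℝ), f (Fin.cons t v) = t * b + ∑ i, v i * a i := by
    intro t v
    have h1 : (Fin.cons t v : Fin (n + 1) → ℝ) =
        t • (Fin.cons 1 0 : Fin (n + 1) → ℝ) + ∑ i, v i • Pi.single (Fin.succ i) (1 : ℝ) := by
      ext j
      refine Fin.cases ?_ (fun j => ?_) j
      · simp [Finset.sum_apply, (Fin.succ_ne_zero _).symm]
      · simp [Finset.sum_apply, Pi.single_apply]
    rw [h1, map_add, map_smul, map_sum]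
    simp [a, b]
  set S := ∑ i, |a i| with hS
  have hS0 : 0 ≤ S := Finset.sum_nonneg fun _ _ => abs_nonneg _
  have hlip : ∀ v : Fin n → ℝ, |∑ i, v i * a i| ≤ S * ‖v‖ := by
    intro v
    refine (Finset.abs_sum_le_sum_abs _ _).trans ?_
    rw [hS, Finset.sum_mul]
    refine Finset.sum_le_sum fun i _ => ?_
    rw [abs_mul, mul_comm]
    gcongr
    exact norm_le_pi_norm v i
  set c := b + ∑ i, z i * a i with hc
  obtain ⟨s, hs1, hsc⟩ : ∃ s : ℝ, |s| = 1 ∧ ∀ t : ℝ, 0 ≤ t → t ≤ |c + s * t| := by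
    rcases le_total 0 c with h | h
    · refine ⟨1, by simp, fun t ht => ?_⟩
      rw [abs_of_nonneg (by linarith)]; linarith
    · refine ⟨-1, by simp, fun t ht => ?_⟩
      rw [abs_of_nonpos (by linarith)]; linarith
  -- The sign vector of `a` is extremal for the duality between max norm and `ℓ¹` norm: this shift
  -- moves away from the hyperplane at full speed, to distance at least `r / 2`.
  set z' : Fin n → ℝ := fun i => z i + s * (r / 2) * (SignType.sign (a i) : ℝ) with hz'
  have hzz' : ‖z' - z‖ ≤ r / 2 := by
    refine (pi_norm_le_iff_of_nonneg (by positivity)).2 fun i => ?_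
    have h1 : |(SignType.sign (a i) : ℝ)| ≤ 1 := by
      rcases lt_trichotomy (a i) 0 with h | h | h <;> simp [h]
    simp only [hz', Pi.sub_apply, add_sub_cancel_left, Real.norm_eq_abs, abs_mul, hs1,
      one_mul, abs_of_pos (half_pos hr)]
    nlinarith
  have hz'val : b + ∑ i, z' i * a i = c + s * (r / 2 * S) := by
    have h1 : ∀ i, z' i * a i = z i * a i + s * (r / 2) * |a i| := by
      intro i
      simp only [hz']
      rw [add_mul, mul_assoc (s * (r / 2)), sign_mul_self]
    simp only [h1, Finset.sum_add_distrib, ← Finset.mul_sum, ← hS]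
    ring
  refine ⟨z', hzz', fun x hx q hq hqs p => ?_⟩
  rw [norm_sub_div_mul x hq]
  have hq' : (0 : ℝ) < q := by exact_mod_cast hq
  gcongr
  set w : Fin n → ℝ := fun i => (p i : ℝ) / q with hw
  by_cases hwz : ‖z - w‖ ≤ r
  swap
  -- Rationals outside the original ball are far anyway: `r - r / 2 - r / 4 = r / 4`.
  · have h1 : ‖z - w‖ ≤ ‖x - w‖ + ‖x - z'‖ + ‖z' - z‖ := by
      have : z - w = (x - w) - (x - z') - (z' - z) := by abel
      rw [this]
      exact (norm_sub_le _ _).trans (by gcongr; exact norm_sub_le _ _)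
    linarith [not_le.1 hwz]
  have hker : f (Fin.cons (q : ℝ) fun i => (p i : ℝ)) = 0 := by
    refine hfker (Submodule.subset_span ⟨q, p, hq, by exact_mod_cast hQmax q hqs, ?_, rfl⟩)
    rw [norm_sub_div_mul z hq]
    gcongr
  have hwker : b + ∑ i, w i * a i = 0 := by
    rw [hfexp] at hker
    have : ∑ i, w i * a i = (∑ i, (p i : ℝ) * a i) / q := by
      rw [Finset.sum_div]
      exact Finset.sum_congr rfl fun i _ => by simp only [hw]; ring
    rw [this]
    field_simp
    linarith
  have hSpos : 0 < S := by
    rcases hS0.lt_or_eq with h | h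
    · exact h
    · exfalso
      have ha0 : ∀ i, a i = 0 := fun i => by
        have := (Finset.sum_eq_zero_iff_of_nonneg (fun i _ => abs_nonneg (a i))).1 h.symm i
          (Finset.mem_univ i)
        simpa using this
      have hb0 : b = 0 := by simpa [ha0] using hwker
      refine hf0 (LinearMap.ext fun v => ?_)
      rw [← Fin.cons_self_tail v, hfexp]
      simp [ha0, hb0]
  have h1 : r / 2 * S ≤ S * ‖z' - w‖ := by
    refine (hsc (r / 2 * S) (by positivity)).trans ?_
    rw [← hz'val]
    have : b + ∑ i, z' i * a i = ∑ i, (z' - w) i * a i := by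
      simp only [Pi.sub_apply, sub_mul, Finset.sum_sub_distrib]
      linarith
    rw [this]
    exact hlip _
  have h2 : r / 2 ≤ ‖z' - w‖ := by
    rw [mul_comm] at h1
    exact le_of_mul_le_mul_left h1 hSpos
  have h3 : ‖z' - w‖ ≤ ‖x - w‖ + ‖x - z'‖ := by
    have : z' - w = (x - w) - (x - z') := by abel
    rw [this]
    exact norm_sub_le _ _
  linarith

/-! ### Badly approximable points with a uniform constant. -/

/-- Every ball contains a point that is badly approximable with a constant depending only on the
dimension, beyond the scale of the ball. -/
lemma exists_badly_approximable {n : ℕ} (hn : 1 ≤ n) :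
    ∃ κ : ℝ, 0 < κ ∧ κ ≤ 1 ∧ ∀ (z : Fin n → ℝ) (r : ℝ), 0 < r → ∃ y : Fin n → ℝ,
      ‖y - z‖ ≤ r / 2 ∧ ∀ q : ℕ, 1 ≤ q → ∀ p : Fin n → ℤ,
        κ * min (r * q) (dirichletRate n q) ≤ linErr y q p := by
  set D : ℝ := ((n + 1).factorial : ℝ) with hD
  have hD1 : 1 ≤ D := by
    rw [hD]; exact_mod_cast Nat.one_le_iff_ne_zero.2 (Nat.factorial_ne_zero _)
  have hD0 : 0 < D := by linarith
  have hκ1 : 1 / (16 * D) ≤ 1 := by rw [div_le_one (by positivity)]; linarith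
  refine ⟨1 / (16 * D), by positivity, hκ1, fun z r hr => ?_⟩
  have step : ∀ (c : Fin n → ℝ) (j : ℕ), ∃ c' : Fin n → ℝ, ‖c' - c‖ ≤ r / 2 / 4 ^ j / 2 ∧
      ∀ x, ‖x - c'‖ ≤ r / 2 / 4 ^ j / 4 → ∀ q : ℕ, 1 ≤ q →
        D * ((q : ℝ) ^ (n + 1) * (r / 2 / 4 ^ j) ^ n) < 1 → ∀ p : Fin n → ℤ,
          q * (r / 2 / 4 ^ j / 4) ≤ linErr x q p :=
    fun c j => exists_ball_avoiding c (by positivity)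
  choose F hF1 hF2 using step
  let c : ℕ → Fin n → ℝ := fun j => Nat.rec z (fun j c => F c j) j
  have hc : ∀ j, c (j + 1) = F (c j) j := fun _ => rfl
  obtain ⟨y, hy⟩ : (⋂ j, Metric.closedBall (c j) (r / 2 / 4 ^ j)).Nonempty := by
    refine IsCompact.nonempty_iInter_of_sequence_nonempty_isCompact_isClosed _ ?_ ?_ ?_ ?_
    · intro j
      refine Metric.closedBall_subset_closedBall' ?_
      have h1 := hF1 (c j) j
      have h2 : 0 < r / 2 / 4 ^ j := by positivity
      rw [dist_eq_norm, hc, pow_succ, ← div_div]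
      linarith
    · exact fun j => Metric.nonempty_closedBall.2 (by positivity)
    · exact isCompact_closedBall _ _
    · exact fun j => Metric.isClosed_closedBall
  rw [Set.mem_iInter] at hy
  simp only [mem_closedBall_iff_norm] at hy
  refine ⟨y, by simpa [c] using hy 0, fun q hq p => ?_⟩
  have hq0 : (1 : ℝ) ≤ q := by exact_mod_cast hq
  have hφ := dirichletRate_pos n hq
  have key : ∀ j : ℕ, D * ((q : ℝ) ^ (n + 1) * (r / 2 / 4 ^ j) ^ n) < 1 →
      q * (r / 2 / 4 ^ j / 4) ≤ linErr y q p := by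
    intro j hj
    refine hF2 (c j) j y ?_ q hq hj p
    have := hy (j + 1)
    rwa [hc, pow_succ, ← div_div] at this
  have hex : ∃ j : ℕ, D * ((q : ℝ) ^ (n + 1) * (r / 2 / 4 ^ j) ^ n) < 1 := by
    have h1 : Filter.Tendsto (fun j : ℕ => D * ((q : ℝ) ^ (n + 1) * (r / 2 / 4 ^ j) ^ n))
        Filter.atTop (nhds (D * ((q : ℝ) ^ (n + 1) * 0 ^ n))) := by
      refine Filter.Tendsto.const_mul _ (Filter.Tendsto.const_mul _ (Filter.Tendsto.pow ?_ _))
      exact Filter.Tendsto.div_atTop tendsto_const_nhds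
        (tendsto_pow_atTop_atTop_of_one_lt (by norm_num))
    rw [zero_pow (by omega), mul_zero, mul_zero] at h1
    exact (h1.eventually (gt_mem_nhds one_pos)).exists
  classical
  have hspec := key _ (Nat.find_spec hex)
  -- At the first scale avoiding `q`: if it is the initial one, the term `r * q` is the bound;
  -- otherwise failure at the previous scale says that `q * R` is at least the rate divided by `D`.
  rcases Nat.eq_zero_or_pos (Nat.find hex) with h0 | h0
  · rw [h0, pow_zero, div_one] at hspec
    refine le_trans ?_ hspec
    calc 1 / (16 * D) * min (r * q) (dirichletRate n q) ≤ 1 / 16 * (r * q) := by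
          gcongr
          · linarith
          · exact min_le_left _ _
      _ ≤ _ := by nlinarith
  · have hlt := Nat.find_min hex (Nat.sub_one_lt_of_lt h0)
    set j := Nat.find hex - 1 with hj
    have hj' : Nat.find hex = j + 1 := by omega
    rw [hj', pow_succ, ← div_div] at hspec
    set R := r / 2 / 4 ^ j with hR
    have hR0 : 0 < R := by positivity
    push Not at hlt
    have h1 : dirichletRate n q ≤ D * (q * R) := by
      refine le_of_pow_mul_le hn (by positivity) (by linarith : (0 : ℝ) < q) ?_
      rw [dirichletRate_pow_mul hn hq, mul_pow, mul_pow]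
      have : D ≤ D ^ n := le_self_pow₀ hD1 (by omega)
      calc (1 : ℝ) ≤ D * ((q : ℝ) ^ (n + 1) * R ^ n) := hlt
        _ ≤ D ^ n * ((q : ℝ) ^ (n + 1) * R ^ n) := by gcongr
        _ = _ := by ring
    refine le_trans ?_ hspec
    calc 1 / (16 * D) * min (r * q) (dirichletRate n q) ≤ 1 / (16 * D) * (D * (q * R)) := by
          gcongr
          exact (min_le_right _ _).trans h1
      _ = _ := by field_simp; ring

/-! ### Dirichlet's theorem and isolated best approximations. -/

/-- Dirichlet's theorem on simultaneous approximation. -/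
lemma exists_linErr_lt {n : ℕ} (y : Fin n → ℝ) {N : ℕ} (hN : 1 ≤ N) :
    ∃ q : ℕ, 1 ≤ q ∧ q ≤ N ^ n ∧ ∃ p : Fin n → ℤ, linErr y q p < 1 / N := by
  have hN0 : (0 : ℝ) < N := by exact_mod_cast hN
  let cell : Fin (N ^ n + 1) → Fin n → Fin N := fun k i =>
    ⟨⌊Int.fract ((k : ℕ) * y i) * N⌋₊, by
      rw [Nat.floor_lt (mul_nonneg (Int.fract_nonneg _) hN0.le)]
      exact (mul_lt_iff_lt_one_left hN0).2 (Int.fract_lt_one _)⟩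
  obtain ⟨k, l, hkl, hcell⟩ := Fintype.exists_ne_map_eq_of_card_lt cell (by simp)
  wlog hlt : k < l generalizing k l
  · exact this l k hkl.symm hcell.symm (lt_of_le_of_ne (not_lt.1 hlt) hkl.symm)
  have hlt' : (k : ℕ) < l := hlt
  refine ⟨l - k, by omega, by omega, fun i => ⌊(l : ℕ) * y i⌋ - ⌊(k : ℕ) * y i⌋, ?_⟩
  rw [linErr, pi_norm_lt_iff (by positivity)]
  intro i
  have h1 : ⌊Int.fract ((k : ℕ) * y i) * N⌋₊ = ⌊Int.fract ((l : ℕ) * y i) * N⌋₊ :=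
    congrArg Fin.val (congrFun hcell i)
  have h2 : |Int.fract ((l : ℕ) * y i) * N - Int.fract ((k : ℕ) * y i) * N| < 1 := by
    have a1 := Nat.floor_le (mul_nonneg (Int.fract_nonneg ((k : ℕ) * y i)) hN0.le)
    have a2 := Nat.floor_le (mul_nonneg (Int.fract_nonneg ((l : ℕ) * y i)) hN0.le)
    have a3 := Nat.lt_floor_add_one (Int.fract ((k : ℕ) * y i) * N)
    have a4 := Nat.lt_floor_add_one (Int.fract ((l : ℕ) * y i) * N)
    rw [h1] at a1 a3
    rw [abs_lt]
    constructor <;> linarith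
  rw [← sub_mul, abs_mul, abs_of_pos hN0, ← lt_div_iff₀ hN0] at h2
  simp only [Pi.sub_apply, Pi.smul_apply, smul_eq_mul, Real.norm_eq_abs]
  simp only [Int.fract] at h2
  push_cast [Nat.cast_sub hlt'.le]
  rwa [show ((l : ℕ) - (k : ℕ) : ℝ) * y i - (⌊(l : ℕ) * y i⌋ - ⌊(k : ℕ) * y i⌋) =
    (l : ℕ) * y i - ⌊(l : ℕ) * y i⌋ - ((k : ℕ) * y i - ⌊(k : ℕ) * y i⌋) by ring]

/-- The vectors `q' w - p'` attached to a best approximation `w = p / q` are either zero or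
well separated from zero. -/
lemma half_le_linErr_of_best {n : ℕ} {y : Fin n → ℝ} {η : ℝ} (hη : 0 < η) (hη1 : η ≤ 1) {q : ℕ}
    (hq : 1 ≤ q) {p : Fin n → ℤ} (hp : linErr y q p < η)
    (hbest : ∀ q' : ℕ, 1 ≤ q' → q' < q → ∀ p' : Fin n → ℤ, η ≤ linErr y q' p')
    (q' : ℕ) (p' : Fin n → ℤ) (hne : linErr (fun i => (p i : ℝ) / q) q' p' ≠ 0) :
    η / 2 ≤ linErr (fun i => (p i : ℝ) / q) q' p' := by
  set w : Fin n → ℝ := fun i => (p i : ℝ) / q with hw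
  have hq0 : (0 : ℝ) < q := by exact_mod_cast hq
  have hyw : q * ‖y - w‖ < η := by rwa [← norm_sub_div_mul y hq p]
  -- For `s ≤ q / 2`, passing from `y` to `w` costs at most `η / 2`. Since `q w` is integral,
  -- reduction modulo `q` and `s ↦ q - s` bring every other case here.
  have hsmall : ∀ s : ℕ, 1 ≤ s → 2 * s ≤ q → ∀ p' : Fin n → ℤ, η / 2 ≤ linErr w s p' := by
    intro s hs hsq p'
    have h1 := hbest s hs (by omega) p'
    have h2 : linErr y s p' ≤ linErr w s p' + s * ‖y - w‖ := by
      have : ((s : ℝ) • y - fun i => (p' i : ℝ)) =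
          ((s : ℝ) • w - fun i => (p' i : ℝ)) + (s : ℝ) • (y - w) := by
        rw [smul_sub]; abel
      rw [linErr, this]
      refine (norm_add_le _ _).trans ?_
      rw [norm_smul, Real.norm_natCast, linErr]
    have h3 : (2 * s : ℝ) ≤ q := by exact_mod_cast hsq
    nlinarith [norm_nonneg (y - w)]
  set m := q' / q with hm
  set s := q' % q with hs
  have hsm : q' = q * m + s := (Nat.div_add_mod q' q).symm
  have hslt : s < q := Nat.mod_lt _ hq
  have hred : linErr w q' p' = linErr w s fun i => p' i - m * p i := by
    simp only [linErr]
    congr 1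
    ext i
    simp only [Pi.sub_apply, Pi.smul_apply, smul_eq_mul, hw]
    rw [hsm]
    push_cast
    field_simp
    ring
  rcases Nat.eq_zero_or_pos s with h0 | h0
  · rw [hred, h0] at hne ⊢
    simp only [linErr, Nat.cast_zero, zero_smul, zero_sub, norm_neg] at hne ⊢
    obtain ⟨i, hi⟩ : ∃ i, p' i - m * p i ≠ 0 := by
      by_contra hall
      push Not at hall
      apply hne
      rw [norm_eq_zero]
      ext i
      simp [hall]
    have h1 := norm_le_pi_norm (fun i => ((p' i - m * p i : ℤ) : ℝ)) i
    have h2 : (1 : ℝ) ≤ |((p' i - m * p i : ℤ) : ℝ)| := by exact_mod_cast Int.one_le_abs hi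
    rw [Real.norm_eq_abs] at h1
    linarith
  by_cases h2 : 2 * s ≤ q
  · rw [hred]
    exact hsmall s h0 h2 _
  · have hflip : linErr w s (fun i => p' i - m * p i) =
        linErr w (q - s) fun i => p i - (p' i - m * p i) := by
      simp only [linErr]
      rw [← norm_neg]
      congr 1
      ext i
      simp only [Pi.sub_apply, Pi.neg_apply, Pi.smul_apply, smul_eq_mul, hw]
      push_cast [Nat.cast_sub hslt.le]
      field_simp
      ring
    rw [hred, hflip]
    exact hsmall _ (by omega) (by omega) _

lemma linErr_le_add {n : ℕ} (x y : Fin n → ℝ) (q : ℕ) (p : Fin n → ℤ) :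
    linErr y q p ≤ linErr x q p + q * ‖x - y‖ := by
  have : ((q : ℝ) • y - fun i => (p i : ℝ)) =
      ((q : ℝ) • x - fun i => (p i : ℝ)) - (q : ℝ) • (x - y) := by
    rw [smul_sub]; abel
  rw [linErr, this]
  refine (norm_sub_le _ _).trans ?_
  rw [norm_smul, Real.norm_natCast, linErr]

/-- A very good rational approximation `p / q` of a badly approximable point `y`, well separated
from the other rational points. -/
lemma exists_isolated_approx {n : ℕ} (hn : 1 ≤ n) {κ r : ℝ} (hκ : 0 < κ) (hr : 0 < r)
    {y : Fin n → ℝ} (hy : ∀ q : ℕ, 1 ≤ q → ∀ p : Fin n → ℤ,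
      κ * min (r * q) (dirichletRate n q) ≤ linErr y q p) (T : ℕ) :
    ∃ (q : ℕ) (p : Fin n → ℤ) (η : ℝ), 1 ≤ q ∧ T ≤ q ∧ 0 < η ∧ η ≤ dirichletRate n q ∧
      κ * dirichletRate n q < η ∧ linErr y q p < η ∧
      (∀ (q' : ℕ) (p' : Fin n → ℤ), linErr (fun i => (p i : ℝ) / q) q' p' ≠ 0 →
        η / 2 ≤ linErr (fun i => (p i : ℝ) / q) q' p') ∧
      ∀ (q' : ℕ) (p' : Fin n → ℤ), 1 ≤ q' → linErr (fun i => (p i : ℝ) / q) q' p' = 0 →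
        q ≤ q' := by
  -- The bound `1 / (κ * r)` rules out the `r * q` branch of the minimum; `T / κ` forces `T ≤ q`.
  obtain ⟨N, hN⟩ := exists_nat_gt (max 1 (max (1 / (κ * r)) (T / κ)))
  rw [max_lt_iff, max_lt_iff] at hN
  obtain ⟨hN1, hNr, hNT⟩ := hN
  have hN0 : (0 : ℝ) < N := by linarith
  have hN1' : 1 ≤ N := by exact_mod_cast hN1.le
  have hη0 : (0 : ℝ) < 1 / N := by positivity
  have hex : ∃ q : ℕ, 1 ≤ q ∧ ∃ p : Fin n → ℤ, linErr y q p < 1 / N := by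
    obtain ⟨q, hq, -, p, hp⟩ := exists_linErr_lt y hN1'
    exact ⟨q, hq, p, hp⟩
  classical
  obtain ⟨q₀, hq₀, hq₀N, hp₀⟩ := exists_linErr_lt y hN1'
  obtain ⟨hq, p, hp⟩ := Nat.find_spec hex
  have hqN : Nat.find hex ≤ N ^ n := (Nat.find_min' hex ⟨hq₀, hp₀⟩).trans hq₀N
  have hbest : ∀ q' : ℕ, 1 ≤ q' → q' < Nat.find hex → ∀ p' : Fin n → ℤ,
      1 / (N : ℝ) ≤ linErr y q' p' := by
    intro q' hq' hlt p'
    by_contra hcon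
    exact Nat.find_min hex hlt ⟨hq', p', not_le.1 hcon⟩
  generalize Nat.find hex = q at hq p hp hqN hbest
  have hq0 : (1 : ℝ) ≤ q := by exact_mod_cast hq
  have hh := dirichletRate_pos n hq
  have hκh : κ * dirichletRate n q < 1 / N := by
    have h1 := (hy q hq p).trans_lt hp
    rcases min_choice (r * q) (dirichletRate n q) with h | h
    · rw [h] at h1
      rw [div_lt_comm₀ (by positivity) hN0] at hNr
      nlinarith [mul_pos hκ hr]
    · rwa [h] at h1
  refine ⟨q, p, 1 / N, hq, ?_, hη0, ?_, hκh, hp, ?_, ?_⟩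
  · have h1 := dirichletRate_pow_mul hn hq
    have h2 : dirichletRate n q ^ n ≤ dirichletRate n q :=
      pow_le_of_le_one hh.le (dirichletRate_le_one n hq) (by omega)
    rw [div_lt_iff₀ hκ] at hNT
    rw [lt_div_iff₀ hN0] at hκh
    have h3 : (1 : ℝ) ≤ dirichletRate n q * q := by
      rw [← h1]; gcongr
    have h4 : (N : ℝ) * κ ≤ q := by
      have : κ * N * (dirichletRate n q * q) ≤ q := by nlinarith
      nlinarith [mul_pos hκ hN0]
    exact_mod_cast (hNT.trans_le h4).le
  · refine le_of_pow_mul_le hn hh.le (by positivity : (0 : ℝ) < q) ?_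
    rw [dirichletRate_pow_mul hn hq, div_pow, one_pow, one_div, inv_mul_le_iff₀ (by positivity),
      mul_one]
    exact_mod_cast hqN
  · intro q' p' hne
    exact half_le_linErr_of_best hη0 (by rw [div_le_one hN0]; exact hN1.le) hq hp hbest q' p' hne
  -- A smaller denominator for the same point `w` would have a smaller error at `y`, against
  -- minimality of `q`.
  · intro q' p' hq' h0
    by_contra hlt
    push Not at hlt
    have h1 := hbest q' hq' hlt p'
    have h2 := linErr_le_add (fun i => (p i : ℝ) / q) y q' p'
    rw [norm_sub_div_mul y hq, norm_sub_rev] at hp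
    rw [h0, zero_add] at h2
    have h3 : (q' : ℝ) ≤ q := by exact_mod_cast hlt.le
    have h4 : (q' : ℝ) * ‖(fun i => (p i : ℝ) / q) - y‖ ≤
        q * ‖(fun i => (p i : ℝ) / q) - y‖ := by gcongr
    linarith

/-! ### The inductive step. -/

set_option maxHeartbeats 1000000 in
/-- One step of the construction: inside a ball there is a smaller ball, avoiding a given point,
all of whose points are exactly approximable up to `δ` in a range of denominators. -/
lemma exists_next_ball {n : ℕ} (hn : 1 ≤ n) {κ : ℝ} (hκ : 0 < κ) (hκ1 : κ ≤ 1)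
    (hbad : ∀ (z : Fin n → ℝ) (r : ℝ), 0 < r → ∃ y : Fin n → ℝ,
      ‖y - z‖ ≤ r / 2 ∧ ∀ q : ℕ, 1 ≤ q → ∀ p : Fin n → ℤ,
        κ * min (r * q) (dirichletRate n q) ≤ linErr y q p)
    {ψ : ℕ → ℝ} (hpos : ∀ s : ℕ, 1 ≤ s → 0 < ψ s) (hmono : AntitoneOn ψ (Set.Ici 1))
    (hlim : ∀ e : ℝ, 0 < e → ∃ M : ℕ, ∀ q : ℕ, 1 ≤ q → M ≤ q → q * ψ q ≤ e * dirichletRate n q)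
    (z : Fin n → ℝ) {r : ℝ} (hr : 0 < r) {A : ℕ} (hA1 : 1 ≤ A)
    (hAr : ∀ q : ℕ, A ≤ q → dirichletRate n q ≤ r * q)
    (hAψ : ∀ q : ℕ, A ≤ q → q * ψ q ≤ κ ^ 2 / 64 * dirichletRate n q)
    {δ : ℝ} (hδ : 0 < δ) (hδ1 : δ ≤ 1) (u : Fin n → ℝ) :
    ∃ (z' : Fin n → ℝ) (r' : ℝ) (A' : ℕ), 0 < r' ∧ A < A' ∧
      Metric.closedBall z' r' ⊆ Metric.closedBall z r ∧ u ∉ Metric.closedBall z' r' ∧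
      (∀ q : ℕ, A' ≤ q → dirichletRate n q ≤ r' * q) ∧
      ∀ x ∈ Metric.closedBall z' r',
        (∃ (q : ℕ) (p : Fin n → ℤ), A ≤ q ∧ linErr x q p < q * ψ q) ∧
        ∀ q : ℕ, A ≤ q → q < A' → ∀ p : Fin n → ℤ, (1 - δ) * (q * ψ q) ≤ linErr x q p := by
  obtain ⟨y, hyz, hy⟩ := hbad z r hr
  -- Chosen so that `hrad` closes: beyond `A'`, `q' * ρ` exceeds `κ / 4` times the rate of `q`, and
  -- `q'` exceeds `κ / (4 * e) * q`.
  set e : ℝ := κ / 4 * (δ * κ / 16) ^ n with he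
  have he0 : 0 < e := by positivity
  have heκ : e ≤ κ / 4 := by
    have : (δ * κ / 16) ^ n ≤ 1 := pow_le_one₀ (by positivity) (by nlinarith)
    nlinarith
  obtain ⟨M, hM⟩ := hlim e he0
  obtain ⟨T, hT⟩ := exists_nat_gt (4 / r)
  obtain ⟨q, p, η, hq, hTq, hη, hηh, hκη, hyη, hsep, hmin⟩ :=
    exists_isolated_approx hn hκ hr hy (max M (max T A))
  simp only [max_le_iff] at hTq
  obtain ⟨hMq, hTq, hAq⟩ := hTq
  set w : Fin n → ℝ := fun i => (p i : ℝ) / q with hw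
  set ρ := ψ q with hρ
  have hρ0 : 0 < ρ := hpos q hq
  have hq0 : (1 : ℝ) ≤ q := by exact_mod_cast hq
  have hh := dirichletRate_pos n hq
  have hh1 := dirichletRate_le_one n hq
  have hqρ : q * ρ ≤ e * dirichletRate n q := hM q hq hMq
  have hyw : q * ‖y - w‖ < η := by rwa [← norm_sub_div_mul y hq]
  have hqr : 4 < r * q := by
    rw [div_lt_iff₀ hr] at hT
    have : (T : ℝ) ≤ q := by exact_mod_cast hTq
    nlinarith
  have hqρ' : q * ρ ≤ κ / 4 * dirichletRate n q := hqρ.trans (by gcongr)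
  have hρr : ρ ≤ r / 4 := by
    have : q * ρ ≤ 1 := hqρ'.trans (by nlinarith)
    nlinarith
  have hywr : ‖y - w‖ ≤ r / 4 := by nlinarith
  -- Below `A'`, moving by `ρ` away from `w` costs at most half of the separation `η / 2`.
  set A' := ⌊η / (4 * ρ)⌋₊ + 1 with hA'
  have hA'lt : ∀ q' : ℕ, q' < A' → q' * ρ ≤ η / 4 := by
    intro q' hq'
    have h1 : (q' : ℝ) ≤ η / (4 * ρ) :=
      (Nat.le_floor_iff (by positivity)).1 (by omega)
    rw [le_div_iff₀ (by positivity)] at h1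
    linarith
  have hA'ge : ∀ q' : ℕ, A' ≤ q' → η / 4 ≤ q' * ρ := by
    intro q' hq'
    have h1 : η / (4 * ρ) < q' := (Nat.lt_floor_add_one _).trans_le (by exact_mod_cast hq')
    rw [div_lt_iff₀ (by positivity)] at h1
    linarith
  have hqA' : q < A' := by
    by_contra hcon
    have h1 := hA'ge q (by omega)
    have h2 : (q : ℝ) * ρ < η / 4 := by nlinarith
    linarith
  have hrad : ∀ q' : ℕ, A' ≤ q' → dirichletRate n q' ≤ δ / 4 * ρ * q' := by
    intro q' hq'
    have h1 := hA'ge q' hq'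
    have hq'1 : 1 ≤ q' := by omega
    have hq'0 : (1 : ℝ) ≤ q' := by exact_mod_cast hq'1
    refine le_of_pow_mul_le hn (by positivity) (by positivity : (0 : ℝ) < q') ?_
    rw [dirichletRate_pow_mul hn hq'1]
    have h2 : δ * κ / 16 * dirichletRate n q ≤ δ / 4 * ρ * q' := by
      have : κ / 4 * dirichletRate n q ≤ q' * ρ := by linarith
      nlinarith
    have h3 : κ / 4 * q ≤ e * q' := by
      have h4 : κ / 4 * dirichletRate n q * q ≤ (q' * ρ) * q :=
        mul_le_mul_of_nonneg_right (by linarith) (by positivity)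
      have h5 : (q' * ρ) * q ≤ q' * (e * dirichletRate n q) := by
        rw [mul_assoc, mul_comm ρ]; gcongr
      refine le_of_mul_le_mul_left ?_ hh
      linarith
    have h6 := dirichletRate_pow_mul hn hq
    refine le_of_mul_le_mul_left ?_ he0
    calc e * 1 = (δ * κ / 16) ^ n * (dirichletRate n q ^ n) * (κ / 4 * q) := by
          rw [he, ← h6]; ring
      _ = (δ * κ / 16 * dirichletRate n q) ^ n * (κ / 4 * q) := by rw [mul_pow]
      _ ≤ (δ / 4 * ρ * q') ^ n * (e * q') := by gcongr
      _ = _ := by ring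
  have hn0 : Nonempty (Fin n) := ⟨⟨0, hn⟩⟩
  -- With radius `δ / 4 * ρ`, distances to `w` stay between `(1 - 3δ/4) * ρ` and `(1 - δ/4) * ρ`.
  -- The two balls `s = ±1` are disjoint, so one misses `u`.
  set t := (1 - δ / 2) * ρ with ht
  have ht0 : 0 < t := mul_pos (by linarith) hρ0
  have hmain : ∀ s : ℝ, |s| = 1 → ∀ x ∈ Metric.closedBall (w + fun _ => s * t) (δ / 4 * ρ),
      (1 - δ) * ρ ≤ ‖x - w‖ ∧ ‖x - w‖ < ρ := by
    intro s hs x hx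
    rw [mem_closedBall_iff_norm] at hx
    have h1 : ‖(fun _ : Fin n => s * t)‖ = t := by
      rw [pi_norm_const, Real.norm_eq_abs, abs_mul, hs, one_mul, abs_of_pos ht0]
    have h2 : x - w = (x - (w + fun _ => s * t)) + fun _ => s * t := by abel
    have h3 := norm_add_le (x - (w + fun _ => s * t)) fun _ => s * t
    have h4 : ‖(fun _ : Fin n => s * t)‖ ≤ ‖x - w‖ + ‖x - (w + fun _ => s * t)‖ := by
      have : (fun _ : Fin n => s * t) = (x - w) - (x - (w + fun _ => s * t)) := by abel
      conv_lhs => rw [this]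
      exact norm_sub_le _ _
    rw [← h2, h1] at h3
    rw [h1] at h4
    constructor <;> nlinarith
  obtain ⟨s, hs, hus⟩ : ∃ s : ℝ, |s| = 1 ∧
      u ∉ Metric.closedBall (w + fun _ => s * t) (δ / 4 * ρ) := by
    by_contra hcon
    push Not at hcon
    have h1 := hcon 1 (by simp)
    have h2 := hcon (-1) (by simp)
    rw [mem_closedBall_iff_norm] at h1 h2
    have h3 : ‖(fun _ : Fin n => 2 * t)‖ = 2 * t := by
      rw [pi_norm_const, Real.norm_eq_abs, abs_of_pos (by linarith)]
    have h4 : (fun _ : Fin n => 2 * t) =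
        (u - (w + fun _ => -1 * t)) - (u - (w + fun _ => 1 * t)) := by
      ext i; simp; ring
    have h5 := norm_sub_le (u - (w + fun _ => -1 * t)) (u - (w + fun _ => 1 * t))
    rw [← h4, h3] at h5
    nlinarith
  refine ⟨w + fun _ => s * t, δ / 4 * ρ, A', by positivity, by omega, ?_, hus, hrad, ?_⟩
  · intro x hx
    have h1 := (hmain s hs x hx).2
    rw [mem_closedBall_iff_norm]
    have h2 : x - z = (x - w) - (y - w) + (y - z) := by abel
    have h3 := norm_add_le ((x - w) - (y - w)) (y - z)
    have h4 := norm_sub_le (x - w) (y - w)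
    rw [h2]
    linarith
  intro x hx
  obtain ⟨hx1, hx2⟩ := hmain s hs x hx
  refine ⟨⟨q, p, hAq, ?_⟩, ?_⟩
  · rw [norm_sub_div_mul x hq]
    gcongr
  intro q' hAq' hq'A' p'
  have hq'1 : 1 ≤ q' := hA1.trans hAq'
  have hq'0 : (1 : ℝ) ≤ q' := by exact_mod_cast hq'1
  have hψ' := hpos q' hq'1
  have hxw := linErr_le_add x w q' p'
  -- If `p' / q'` is `w` itself, then `q ≤ q'` and monotonicity gives `ψ q' ≤ ρ`.
  by_cases hz : linErr w q' p' = 0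
  · have hqq' := hmin q' p' hq'1 hz
    have h1 : ψ q' ≤ ρ := hmono (Set.mem_Ici.2 hq) (Set.mem_Ici.2 hq'1) hqq'
    have h2 : linErr x q' p' = q' * ‖x - w‖ := by
      have h3 : (fun i => (p' i : ℝ)) = (q' : ℝ) • w := by
        rw [linErr, norm_eq_zero, sub_eq_zero] at hz
        exact hz.symm
      rw [linErr, h3, ← smul_sub, norm_smul, Real.norm_natCast]
    rw [h2]
    have h4 : (1 - δ) * ψ q' ≤ ‖x - w‖ := le_trans (by gcongr) hx1
    calc (1 - δ) * (q' * ψ q') = q' * ((1 - δ) * ψ q') := by ring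
      _ ≤ _ := by gcongr
  · have hup : q' * ψ q' ≤ linErr x q' p' := by
      have hψκ := hAψ q' hAq'
      have hh' := dirichletRate_pos n hq'1
      -- Small `q'` inherit bad approximability from `y`, as `q' * ‖x - y‖` is at most `κ / 2` times
      -- the rate of `q'`. For larger `q'` that rate is at most `4 / κ` times the rate of `q`, and
      -- the separation from `w` suffices.
      by_cases hsm : 4 * (q' : ℝ) ≤ κ * q
      · have h1 := hy q' hq'1 p'
        rw [min_eq_right (hAr q' hAq')] at h1
        have h2 := linErr_le_add x y q' p'
        have h3 : ‖x - y‖ ≤ ‖x - w‖ + ‖y - w‖ := by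
          have : x - y = (x - w) - (y - w) := by abel
          rw [this]; exact norm_sub_le _ _
        have h4 : (q' : ℝ) ≤ q := by nlinarith
        have h5 : dirichletRate n q ≤ dirichletRate n q' :=
          dirichletRate_anti hn hq'1 (by exact_mod_cast h4)
        have h6 : q' * ‖x - y‖ ≤ κ / 4 * (q * ‖x - w‖ + q * ‖y - w‖) := by
          calc q' * ‖x - y‖ ≤ (κ / 4 * q) * (‖x - w‖ + ‖y - w‖) := by
                gcongr
                linarith
            _ = _ := by ring
        have h7 : q * ‖x - w‖ ≤ dirichletRate n q' := by
          have : q * ‖x - w‖ ≤ q * ρ := by gcongr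
          nlinarith
        have h8 : q' * ‖x - y‖ ≤ κ / 4 * (dirichletRate n q' + dirichletRate n q') := by
          refine h6.trans ?_
          gcongr
          linarith
        have h9 : κ ^ 2 / 64 * dirichletRate n q' ≤ κ / 2 * dirichletRate n q' :=
          mul_le_mul_of_nonneg_right (by nlinarith) hh'.le
        linarith
      · push Not at hsm
        have h1 := hsep q' p' hz
        have h2 := hA'lt q' hq'A'
        have h3 : dirichletRate n q' ≤ 4 / κ * dirichletRate n q := by
          refine dirichletRate_le_mul hn hq hq'1 ?_ ?_
          · rw [le_div_iff₀ hκ]; linarith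
          · rw [div_mul_eq_mul_div, le_div_iff₀ hκ]; linarith
        have h4 : κ ^ 2 / 64 * dirichletRate n q' ≤ η / 16 := by
          calc κ ^ 2 / 64 * dirichletRate n q' ≤ κ ^ 2 / 64 * (4 / κ * dirichletRate n q) := by
                gcongr
            _ = κ * dirichletRate n q / 16 := by field_simp; ring
            _ ≤ η / 16 := by linarith
        have h5 : q' * ‖x - w‖ ≤ q' * ρ := by gcongr
        linarith
    have : 0 ≤ δ * (q' * ψ q') := by positivity
    linarith

/-! ### Passage to the limit and uncountability. -/

lemma eventually_mul_le_dirichletRate {n : ℕ} (hn : 1 ≤ n) {ψ : ℕ → ℝ}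
    (hlim : Filter.Tendsto (fun s : ℕ => (s : ℝ) ^ (((n : ℝ) + 1) / (n : ℝ)) * ψ s)
      Filter.atTop (nhds 0)) {e : ℝ} (he : 0 < e) :
    ∃ M : ℕ, ∀ q : ℕ, 1 ≤ q → M ≤ q → q * ψ q ≤ e * dirichletRate n q := by
  obtain ⟨M, hM⟩ := Filter.eventually_atTop.1 (hlim.eventually (gt_mem_nhds he))
  refine ⟨M, fun q hq hMq => ?_⟩
  have hq0 : (0 : ℝ) < q := by exact_mod_cast hq
  have hn0 : (n : ℝ) ≠ 0 := by positivity
  have h1 : (q : ℝ) ^ (((n : ℝ) + 1) / n) * dirichletRate n q = q := by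
    rw [dirichletRate, ← Real.rpow_add hq0,
      show ((n : ℝ) + 1) / n + -(1 / (n : ℝ)) = 1 by field_simp; ring, Real.rpow_one]
  calc q * ψ q = (q : ℝ) ^ (((n : ℝ) + 1) / n) * ψ q * dirichletRate n q := by
        conv_lhs => rw [← h1]
        ring
    _ ≤ _ := mul_le_mul_of_nonneg_right (hM q hMq).le (dirichletRate_pos n hq).le

/-- A sufficient criterion for exact approximability. -/
lemma mem_exactPsiApprox_of_linErr {n : ℕ} {ψ : ℕ → ℝ} (hpos : ∀ s : ℕ, 1 ≤ s → 0 < ψ s)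
    (hzero : Filter.Tendsto ψ Filter.atTop (nhds 0)) {x : Fin n → ℝ}
    (hup : ∀ B : ℕ, ∃ (q : ℕ) (p : Fin n → ℤ), 1 ≤ q ∧ B ≤ q ∧ linErr x q p < q * ψ q)
    (hlow : ∀ c : ℝ, c < 1 → ∃ B : ℕ, ∀ q : ℕ, 1 ≤ q → B ≤ q → ∀ p : Fin n → ℤ,
      c * (q * ψ q) ≤ linErr x q p) :
    x ∈ exactPsiApprox n ψ := by
  have hcast : ∀ (q : ℕ) (p : Fin n → ℤ) (v : Fin n → ℚ), (∀ i, v i = (p i : ℚ) / (q : ℚ)) →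
      (fun i => (v i : ℝ)) = fun i => (p i : ℝ) / q := by
    intro q p v hv
    ext i
    rw [hv i]
    push_cast
    rfl
  refine ⟨?_, ?_⟩
  · intro hfin
    obtain ⟨B, hB⟩ := hlow (1 / 2) (by norm_num)
    -- Infinitely many `q` could represent finitely many points. Applying the lower bound to a large
    -- multiple of the denominator shows that `x` is not rational, so finitely many points would
    -- stay at a positive distance while `ψ` tends to zero.
    have hirr : ∀ v : Fin n → ℚ, (∃ (p : Fin n → ℤ) (q : ℕ), 1 ≤ q ∧
        ∀ i, v i = (p i : ℚ) / (q : ℚ)) → 0 < ‖x - fun i => (v i : ℝ)‖ := by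
      rintro v ⟨p, q, hq, hv⟩
      have hqm : 1 ≤ q * (B + 1) := Nat.mul_pos hq (by omega)
      have h1 := hB (q * (B + 1)) hqm (by nlinarith) fun i => (B + 1) * p i
      have h2 := hpos _ hqm
      have h3 : (0 : ℝ) < ((q * (B + 1) : ℕ) : ℝ) := by exact_mod_cast hqm
      have h4 : (fun i => (((B + 1) * p i : ℤ) : ℝ) / ((q * (B + 1) : ℕ) : ℝ)) =
          fun i => (v i : ℝ) := by
        rw [hcast q p v hv]
        ext i
        have hq0 : (0 : ℝ) < q := by exact_mod_cast hq
        push_cast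
        field_simp
      rw [norm_sub_div_mul x hqm, h4] at h1
      have h5 : 0 < 1 / 2 * (((q * (B + 1) : ℕ) : ℝ) * ψ (q * (B + 1))) := by positivity
      exact pos_of_mul_pos_right (h5.trans_le h1) h3.le
    obtain ⟨m, hm, hmv⟩ : ∃ m : ℝ, 0 < m ∧ ∀ v ∈ {v : Fin n → ℚ | ∃ (p : Fin n → ℤ) (q : ℕ),
        1 ≤ q ∧ (∀ i, v i = (p i : ℚ) / (q : ℚ)) ∧ ‖x - fun i => (v i : ℝ)‖ < ψ q},
        m ≤ ‖x - fun i => (v i : ℝ)‖ := by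
      rcases Set.eq_empty_or_nonempty {v : Fin n → ℚ | ∃ (p : Fin n → ℤ) (q : ℕ),
        1 ≤ q ∧ (∀ i, v i = (p i : ℚ) / (q : ℚ)) ∧ ‖x - fun i => (v i : ℝ)‖ < ψ q} with h | h
      · exact ⟨1, one_pos, by simp [h]⟩
      · obtain ⟨v, hv, hmin⟩ := Set.exists_min_image _
          (fun v : Fin n → ℚ => ‖x - fun i => (v i : ℝ)‖) hfin h
        obtain ⟨p, q, hq, hpq, -⟩ := hv
        exact ⟨_, hirr v ⟨p, q, hq, hpq⟩, hmin⟩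
    obtain ⟨C, hC⟩ := Filter.eventually_atTop.1 (hzero.eventually (gt_mem_nhds hm))
    obtain ⟨q, p, hq, hCq, hlt⟩ := hup C
    rw [norm_sub_div_mul x hq] at hlt
    have hlt' := lt_of_mul_lt_mul_left hlt (Nat.cast_nonneg q)
    have hv : ∀ i, (fun i => (p i : ℚ) / (q : ℚ)) i = (p i : ℚ) / (q : ℚ) := fun _ => rfl
    rw [← hcast q p _ hv] at hlt'
    have := hmv _ ⟨p, q, hq, hv, hlt'⟩
    linarith [hC q hCq]
  · simp only [Set.mem_iUnion, Set.mem_Iio, not_exists]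
    intro c hc hinf
    apply hinf
    obtain ⟨B, hB⟩ := hlow c hc
    have hsub : {v : Fin n → ℚ | ∃ (p : Fin n → ℤ) (q : ℕ),
        1 ≤ q ∧ (∀ i, v i = (p i : ℚ) / (q : ℚ)) ∧ ‖x - fun i => (v i : ℝ)‖ < c * ψ q} ⊆
        ⋃ q ∈ Finset.Icc 1 B, (fun (p : Fin n → ℤ) i => (p i : ℚ) / (q : ℚ)) ''
          {p | linErr x q p ≤ q * (c * ψ q)} := by
      rintro v ⟨p, q, hq, hv, hlt⟩
      rw [hcast q p v hv] at hlt
      have hq0 : (0 : ℝ) < q := by exact_mod_cast hq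
      have h1 : linErr x q p < q * (c * ψ q) := by
        rw [norm_sub_div_mul x hq]
        gcongr
      have hqB : q ≤ B := by
        by_contra hcon
        have := hB q hq (by omega) p
        nlinarith
      simp only [Set.mem_iUnion]
      exact ⟨q, Finset.mem_Icc.2 ⟨hq, hqB⟩, p, h1.le, funext fun i => (hv i).symm⟩
    refine Set.Finite.subset (Set.Finite.biUnion (Finset.finite_toSet _) fun q _ => ?_) hsub
    refine Set.Finite.image _ (Set.Finite.subset (Set.finite_Icc
      (fun i => ⌊q * x i - q * (c * ψ q)⌋) fun i => ⌈q * x i + q * (c * ψ q)⌉) ?_)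
    intro p hp
    have h1 : ∀ i, |q * x i - p i| ≤ q * (c * ψ q) := fun i => by
      have := (norm_le_pi_norm ((q : ℝ) • x - fun i => (p i : ℝ)) i).trans hp
      simpa using this
    refine ⟨fun i => ?_, fun i => ?_⟩
    · have := (abs_le.1 (h1 i)).2
      exact_mod_cast (Int.floor_le _).trans (by linarith : _ ≤ (p i : ℝ))
    · have := (abs_le.1 (h1 i)).1
      exact_mod_cast (by linarith : (p i : ℝ) ≤ q * x i + q * (c * ψ q)).trans (Int.le_ceil _)

/-- No sequence exhausts the exactly approximable points. -/
lemma exists_mem_exactPsiApprox_notMem_range {n : ℕ} (hn : 1 ≤ n) {ψ : ℕ → ℝ}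
    (hpos : ∀ s : ℕ, 1 ≤ s → 0 < ψ s) (hmono : AntitoneOn ψ (Set.Ici 1))
    (hlim : ∀ e : ℝ, 0 < e → ∃ M : ℕ, ∀ q : ℕ, 1 ≤ q → M ≤ q → q * ψ q ≤ e * dirichletRate n q)
    (u : ℕ → Fin n → ℝ) : ∃ x ∈ exactPsiApprox n ψ, x ∉ Set.range u := by
  obtain ⟨κ, hκ, hκ1, hbad⟩ := exists_badly_approximable hn
  let P : (Fin n → ℝ) × ℝ × ℕ → Prop := fun s => 0 < s.2.1 ∧ 1 ≤ s.2.2 ∧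
    (∀ q : ℕ, s.2.2 ≤ q → dirichletRate n q ≤ s.2.1 * q) ∧
    ∀ q : ℕ, s.2.2 ≤ q → q * ψ q ≤ κ ^ 2 / 64 * dirichletRate n q
  have step : ∀ (s : {s // P s}) (k : ℕ), ∃ s' : {s // P s}, s.1.2.2 < s'.1.2.2 ∧
      Metric.closedBall s'.1.1 s'.1.2.1 ⊆ Metric.closedBall s.1.1 s.1.2.1 ∧
      u k ∉ Metric.closedBall s'.1.1 s'.1.2.1 ∧ ∀ x ∈ Metric.closedBall s'.1.1 s'.1.2.1,
        (∃ (q : ℕ) (p : Fin n → ℤ), s.1.2.2 ≤ q ∧ linErr x q p < q * ψ q) ∧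
        ∀ q : ℕ, s.1.2.2 ≤ q → q < s'.1.2.2 → ∀ p : Fin n → ℤ,
          (1 - 1 / ((k : ℝ) + 1)) * (q * ψ q) ≤ linErr x q p := by
    rintro ⟨⟨z, r, A⟩, hr, hA1, hAr, hAψ⟩ k
    obtain ⟨z', r', A', hr', hAA', hsub, hu, hAr', hx⟩ :=
      exists_next_ball hn hκ hκ1 hbad hpos hmono hlim z hr hA1 hAr hAψ
        -- At `k = 0` this is `δ = 1`, where the lower bound is void.
        (δ := 1 / ((k : ℝ) + 1)) (by positivity)
        (by rw [div_le_one (by positivity)]; linarith [Nat.cast_nonneg (α := ℝ) k]) (u k)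
    exact ⟨⟨⟨z', r', A'⟩, hr', hA1.trans hAA'.le, hAr', fun q hq => hAψ q (hAA'.le.trans hq)⟩,
      hAA', hsub, hu, hx⟩
  choose F hF using step
  obtain ⟨M, hM⟩ := hlim (κ ^ 2 / 64) (by positivity)
  let s₀ : {s // P s} := ⟨⟨0, 1, M + 1⟩, one_pos, by simp, fun q hq => by
      have hq1 : 1 ≤ q := by simp only at hq; omega
      have : (1 : ℝ) ≤ q := by exact_mod_cast hq1
      linarith [dirichletRate_le_one n hq1],
    fun q hq => hM q (by simp only at hq; omega) (by simp only at hq; omega)⟩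
  obtain ⟨s, hs⟩ : ∃ s : ℕ → {s // P s}, ∀ k, s (k + 1) = F (s k) k :=
    ⟨fun k => Nat.rec s₀ (fun k t => F t k) k, fun _ => rfl⟩
  have hstep := fun k => hF (s k) k
  simp only [← hs] at hstep
  obtain ⟨x, hx⟩ : (⋂ k, Metric.closedBall (s k).1.1 (s k).1.2.1).Nonempty :=
    IsCompact.nonempty_iInter_of_sequence_nonempty_isCompact_isClosed _
      (fun k => (hstep k).2.1) (fun k => Metric.nonempty_closedBall.2 (s k).2.1.le)
      (isCompact_closedBall _ _) fun k => Metric.isClosed_closedBall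
  rw [Set.mem_iInter] at hx
  have hAmono : StrictMono fun k => (s k).1.2.2 := strictMono_nat_of_lt_succ fun k => (hstep k).1
  refine ⟨x, mem_exactPsiApprox_of_linErr hpos ?_ ?_ ?_, ?_⟩
  · obtain ⟨M, hM⟩ := hlim 1 one_pos
    refine squeeze_zero' (g := fun q : ℕ => 1 / (q : ℝ)) ?_ ?_ tendsto_one_div_atTop_nhds_zero_nat
    · filter_upwards [Filter.eventually_ge_atTop 1] with q hq using (hpos q hq).le
    · filter_upwards [Filter.eventually_ge_atTop 1, Filter.eventually_ge_atTop M] with q hq hMq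
      have hq0 : (0 : ℝ) < q := by exact_mod_cast hq
      rw [le_div_iff₀ hq0, mul_comm]
      linarith [hM q hq hMq, dirichletRate_le_one n hq]
  · intro B
    obtain ⟨q, p, hq, hlt⟩ := ((hstep B).2.2.2 x (hx _)).1
    exact ⟨q, p, (s B).2.2.1.trans hq, (hAmono.le_apply).trans hq, hlt⟩
  · intro c hc
    obtain ⟨k, hk⟩ := exists_nat_gt (1 / (1 - c))
    refine ⟨(s k).1.2.2, fun q hq1 hq p => ?_⟩
    -- The ranges between successive thresholds cover all large `q`; the one containing `q` has
    -- index `j ≥ k`, hence `δ ≤ 1 - c`.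
    have hex : ∃ j, q < (s j).1.2.2 := ⟨q + 1, (Nat.lt_succ_self q).trans_le hAmono.le_apply⟩
    classical
    have hj := Nat.find_spec hex
    have hkj : k < Nat.find hex := by
      by_contra hcon
      have := hAmono.monotone (not_lt.1 hcon)
      omega
    obtain ⟨j, hj'⟩ : ∃ j, Nat.find hex = j + 1 := ⟨Nat.find hex - 1, by omega⟩
    have hjq : (s j).1.2.2 ≤ q := not_lt.1 (Nat.find_min hex (by omega))
    rw [hj'] at hj
    refine le_trans ?_ (((hstep j).2.2.2 x (hx _)).2 q hjq hj p)
    have hψ := hpos q hq1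
    have hkj' : (k : ℝ) ≤ j := by exact_mod_cast (by omega : k ≤ j)
    have hc' : 0 < 1 - c := by linarith
    gcongr
    have : 1 / ((j : ℝ) + 1) ≤ 1 - c := by
      rw [div_lt_iff₀ hc'] at hk
      rw [div_le_iff₀ (by positivity)]
      nlinarith
    linarith
  · rintro ⟨k, rfl⟩
    exact (hstep k).2.2.1 (hx _)

theorem mainTheorem2 (n : ℕ) (hn : 1 ≤ n) (ψ : ℕ → ℝ)
    (hpos : ∀ s : ℕ, 1 ≤ s → 0 < ψ s)
    (hmono : AntitoneOn ψ (Set.Ici 1))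
    (hlim : Filter.Tendsto (fun s : ℕ => (s : ℝ) ^ (((n : ℝ) + 1) / (n : ℝ)) * ψ s)
      Filter.atTop (nhds 0)) :
    (exactPsiApprox n ψ).Nonempty ∧ ¬ (exactPsiApprox n ψ).Countable := by
  have key := exists_mem_exactPsiApprox_notMem_range hn hpos hmono
    fun e he => eventually_mul_le_dirichletRate hn hlim he
  refine ⟨?_, fun hcount => ?_⟩
  · obtain ⟨x, hx, -⟩ := key fun _ => 0
    exact ⟨x, hx⟩
  · obtain ⟨u, hu⟩ := Set.countable_iff_exists_subset_range.1 hcount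
    obtain ⟨x, hx, hxu⟩ := key u
    exact hxu (hu hx)
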